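/- **Language.** Consider the following language for a universe of things, each of which is a set or a function. Variables $X,Y,Z,\dots$ range over sets, $\alpha,\beta,\gamma,\xi,\dots$ over all things, and, for a term $t$, composite variables $f_t,h_t,\dots$ over functions on the set $t$. There are constants $\emptyset$, $\omega$, $1_\emptyset$; a function symbol $t^+=\{t\}$; terms $f(t)$ (for "the $\beta$ with $f:t\mapsto\beta$"); and variables for families of ur-functions $(f_{\{\xi\}})_{\xi\in X}$ (each $f_{\{\xi\}}$ is a function on the singleton $\{\xi\}$), with member terms $f_{\{t\}}$. Atomic formulas are $s=t$, $s\in t$, $f:s\twoheadrightarrow t$ and $f:s\mapsto t$. Formulas are built with the classical connectives, quantifiers over the variables above, the multiple quantifier $(\forall f_{\{\xi\}})_{\xi\in X}$ and the conjunctive operator $\bigwedge_{\xi\in X}F:\xi\mapsto f_{\{\xi\}}(\xi)$. A formula is standard if neither the multiple quantifier nor the conjunctive operator occurs in it. As usual $(\exists f_{\{\xi\}})_{\xi\in X}:=\neg(\forall f_{\{\xi\}})_{\xi\in X}\neg$. **Logic.** $T\Vvdash\varphi$ means that $\varphi$ is derivable from $T$ in classical natural deduction with equality (with introduction and elimination rules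 for quantifiers over each sort of variables; every thing is a set or a function; $f:t\mapsto f(t)$ follows from $\exists!\beta\,(f:t\mapsto\beta)$), extended by the nonstandard rules: 1. introduction of the multiple quantifier by generalization over an arbitrary family of ur-functions indexed in $X$, and its elimination by instantiation with a given such family; 2. from $\forall\xi\in X\,\exists h_{\{\xi\}}\,\Phi(\xi,h_{\{\xi\}})$ infer $(\exists f_{\{\xi\}})_{\xi\in X}\,\forall\xi\in X\,\Phi(\xi,f_{\{\xi\}})$; 3. from $F:\xi\mapsto f_{\{\xi\}}(\xi)$ for arbitrary $\xi\in X$ infer $\bigwedge_{\xi\in X}F:\xi\mapsto f_{\{\xi\}}(\xi)$; 4. from $\bigwedge_{\xi\in X}F:\xi\mapsto f_{\{\xi\}}(\xi)$ and $s\in X$ infer $F:s\mapsto f_{\{s\}}(s)$. A theory $T$ is consistent if $T\not\Vvdash\bot$. **Axioms.** The standard axioms are: - $\forall X\forall Y(X=Y\Leftrightarrow\forall\alpha(\alpha\in X\Leftrightarrow\alpha\in Y))$ - $\forall X\forall f_X\forall Y(f_X\ne Y)$ - $\forall X\forall\alpha\forall\beta(\neg\,X:\alpha\twoheadrightarrow\beta\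 \wedge\ \neg\,X:\alpha\mapsto\beta)$ - $\exists X(X=\emptyset\wedge\forall\alpha(\alpha\notin X))$ - $\forall\alpha\forall\beta\exists X\forall\gamma(\gamma\in X\Leftrightarrow\gamma=\alpha\vee\gamma=\beta)$ - $\forall X\exists Y\forall\alpha(\alpha\in Y\Leftrightarrow\exists Z(Z\in X\wedge\alpha\in Z))$ - $\forall X\exists Y\forall\alpha(\alpha\in Y\Leftrightarrow\exists Z(Z\subseteq X\wedge\alpha=Z))$ - $\forall X\ne\emptyset\,\exists\alpha(\alpha\in X\wedge\forall\beta(\beta\in\alpha\Rightarrow\beta\notin X))$ - $\exists X(X=\omega\wedge\emptyset\in\omega\wedge\forall\alpha(\alpha\in\omega\Rightarrow\alpha^+\in\omega)\wedge\forall\beta\in\omega(\neg\exists\gamma\in\omega(\beta=\gamma^+)\Leftrightarrow\beta=\emptyset))$ - $\forall\alpha\forall\beta(\beta=\alpha^+\Leftrightarrow\exists X(\beta=X\wedge\forall\gamma(\gamma\in X\Leftrightarrow\gamma=\alpha)))$ - $\forall X\forall f_X\forall\alpha(\alpha\notin f_X)$ - $\forall X\forall f_X(X\ne\emptyset\Rightarrow\exists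 Y\exists Z(f_X:Y\twoheadrightarrow Z\wedge\forall\alpha\in Y\exists!\beta(f_X:\alpha\mapsto\beta)))$ - $\forall X\forall f_X\forall\alpha(\alpha\ne X\Rightarrow\forall\xi\,\neg(f_X:\alpha\twoheadrightarrow\xi))$ - $\forall X\forall f_X\forall\alpha\notin X\,\forall\beta\,\neg(f_X:\alpha\mapsto\beta)$ - $\forall X\forall f_X(X\ne\emptyset\Rightarrow\forall\beta(f_X:X\twoheadrightarrow\beta\Rightarrow\exists Z(\beta=Z\wedge\forall\gamma(\gamma\in Z\Leftrightarrow\exists\eta\in X(f_X:\eta\mapsto\gamma)))))$ - $\forall X\ne\emptyset\,\forall f_X\forall Y(f_X:X\twoheadrightarrow Y\Rightarrow\forall\beta\exists Z\forall\alpha(\alpha\in Z\Leftrightarrow\alpha\in X\wedge f_X:\alpha\mapsto\beta))$ - $\exists f_\emptyset(f_\emptyset=1_\emptyset\wedge f_\emptyset:\emptyset\twoheadrightarrow\emptyset\wedge\forall\alpha\forall\beta\,\neg(f_\emptyset:\alpha\mapsto\beta))$ - $\forall\alpha\forall\beta\exists f_{\alpha^+}(f_{\alpha^+}:\alpha^+\twoheadrightarrow\beta^+\wedge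 f_{\alpha^+}:\alpha\mapsto\beta)$ - $\forall X\forall f_X\forall Y(f_X:X\twoheadrightarrow Y\Rightarrow\forall\alpha(\neg(f_X:f_X\mapsto\alpha)\wedge\neg(f_X:\alpha\mapsto f_X)))$ The theory $\mathfrak T^\infty_0$ consists of the standard axioms, all instances for standard formulas $\Phi,\Psi$ (with parameters) of $$\forall X\exists Y\forall\alpha(\alpha\in Y\Leftrightarrow\alpha\in X\wedge\Phi(\alpha)),$$ $$\forall X\big(\forall\alpha\in X\,\exists!\beta\,\Psi(\alpha,\beta)\Rightarrow\exists Z\forall\gamma(\gamma\in Z\Leftrightarrow\exists\xi(\xi\in X\wedge\Psi(\xi,\gamma)))\big),$$ and the reverse-graph axiom $$\forall f\forall X\forall Y\big(f\in Y^X\Rightarrow\exists h_X\forall\alpha\forall\beta(h_X:\alpha\mapsto\beta\Leftrightarrow(\alpha,\beta)\in f)\big),$$ where $f$ ranges over sets, $(\alpha,\beta)=\{\alpha,\{\alpha,\beta\}\}$, and $f\in Y^X$ says that the set $f$ is the graph of a function from $X$ to $Y$. The Sum Function Axiom is $$\text{SUM-F}:\quad\forall X(\forall f_{\{\xi\}})_{\xi\in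 X}\exists F_X\exists Y\Big[F_X:X\twoheadrightarrow Y\wedge\bigwedge_{\xi\in X}F_X:\xi\mapsto f_{\{\xi\}}(\xi)\Big].$$ $\mathfrak T$ is the theory given by the standard axioms and SUM-F. **Proposition.** The negation of SUM-F cannot be derived from $\mathfrak T^\infty_0$: $$\mathfrak T^\infty_0\not\Vvdash\neg\,\text{SUM-F}.$$ Moreover, if $\mathfrak T^\infty_0$ is consistent (in the sense of $\Vvdash$), then so are $\mathfrak T^\infty_0\cup\{\text{SUM-F}\}$ and $\mathfrak T$. -/

import Mathlib

/-!  The language, the calculus and the postulates of a theory of sets and functions with a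
multiple quantifier and a conjunctive operator.

Bound variables are represented by de Bruijn indices.  There are two kinds of variables:

* thing variables `Term.var n` (sets, functions, arbitrary things; which of these is meant is
  determined by the quantifier that binds the variable);
* family variables, numbered by natural numbers `k`; a family variable stands for a family of
  ur-functions `(f_{ξ})_{ξ ∈ X}`, and `Term.fam k t` is its member `f_{t}` on the singleton of `t`.

The constants for individual sets, functions and families that occur in informal derivations
are the free variables of the calculus below.
-/

namespace FunSet

/-- Terms. -/
inductive Term : Type
  /-- A thing variable. -/
  | var (n : ℕ)
  /-- The empty set. -/
  | empty
  /-- The set of all finite Zermelo ordinals. -/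
  | omega
  /-- The inactive function `1_∅`. -/
  | inactive
  /-- `t⁺ = {t}`, the singleton of `t` (its Zermelo successor). -/
  | succ (t : Term)
  /-- The member `f_{t}` of the `k`-th family of ur-functions. -/
  | fam (k : ℕ) (t : Term)
  /-- `f(t)`, the thing `β` with `f : t ↦ β`. -/
  | val (f t : Term)

/-- Formulas. Negation, conjunction etc. are defined from `bot` and `imp` below. -/
inductive Formula : Type
  /-- `s = t`. -/
  | eq (s t : Term)
  /-- `s ∈ t`. -/
  | mem (s t : Term)
  /-- `f : s ↠ t`. -/
  | surj (f s t : Term)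
  /-- `f : s ↦ t`. -/
  | maps (f s t : Term)
  | bot
  | imp (φ ψ : Formula)
  /-- `∀ α, φ`, with `α` ranging over all things. -/
  | all (φ : Formula)
  /-- `∀ X, φ`, with `X` ranging over sets. -/
  | allSet (φ : Formula)
  /-- `∀ f_t, φ`, with `f_t` ranging over the functions on the set `t`
  (the bound variable does not occur in `t`). -/
  | allFun (t : Term) (φ : Formula)
  /-- The multiple quantifier `(∀ f_{ξ})_{ξ ∈ t} φ`; it binds a family variable. -/
  | allFam (t : Term) (φ : Formula)
  /-- The conjunctive operator `⋀_{ξ ∈ t} F : ξ ↦ f_{ξ}(ξ)`, for the `k`-th family. -/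
  | bigAnd (t F : Term) (k : ℕ)

namespace Term

/-- Simultaneous substitution of terms for thing variables and of family variables for family
variables. -/
def subst (σ : ℕ → Term) (ρ : ℕ → ℕ) : Term → Term
  | var n => σ n
  | empty => empty
  | omega => omega
  | inactive => inactive
  | succ t => succ (t.subst σ ρ)
  | fam k t => fam (ρ k) (t.subst σ ρ)
  | val f t => val (f.subst σ ρ) (t.subst σ ρ)

/-- Pass below a binder of a thing variable. -/
def shift (t : Term) : Term := t.subst (fun n => var (n + 1)) id

/-- Pass below a binder of a family variable. -/
def shiftFam (t : Term) : Term := t.subst var Nat.succ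

end Term

open Term (var empty omega inactive succ fam val)

/-- The sequence `a, s 0, s 1, …`. -/
def scons {α : Type} (a : α) (s : ℕ → α) : ℕ → α
  | 0 => a
  | n + 1 => s n

/-- A substitution, below a binder of a thing variable. -/
def up (σ : ℕ → Term) : ℕ → Term
  | 0 => var 0
  | n + 1 => (σ n).shift

/-- A renaming of family variables, below a binder of a family variable. -/
def upFam (ρ : ℕ → ℕ) : ℕ → ℕ
  | 0 => 0
  | k + 1 => ρ k + 1

namespace Formula

/-- Simultaneous (capture-avoiding) substitution in a formula. -/
def subst : Formula → (ℕ → Term) → (ℕ → ℕ) → Formula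
  | eq s t, σ, ρ => eq (s.subst σ ρ) (t.subst σ ρ)
  | mem s t, σ, ρ => mem (s.subst σ ρ) (t.subst σ ρ)
  | surj f s t, σ, ρ => surj (f.subst σ ρ) (s.subst σ ρ) (t.subst σ ρ)
  | maps f s t, σ, ρ => maps (f.subst σ ρ) (s.subst σ ρ) (t.subst σ ρ)
  | bot, _, _ => bot
  | imp φ ψ, σ, ρ => imp (φ.subst σ ρ) (ψ.subst σ ρ)
  | all φ, σ, ρ => all (φ.subst (up σ) ρ)
  | allSet φ, σ, ρ => allSet (φ.subst (up σ) ρ)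
  | allFun t φ, σ, ρ => allFun (t.subst σ ρ) (φ.subst (up σ) ρ)
  | allFam t φ, σ, ρ =>
      allFam (t.subst σ ρ) (φ.subst (fun n => (σ n).shiftFam) (upFam ρ))
  | bigAnd t F k, σ, ρ => bigAnd (t.subst σ ρ) (F.subst σ ρ) (ρ k)

/-- Pass below a binder of a thing variable. -/
def shift (φ : Formula) : Formula := φ.subst (fun n => var (n + 1)) id

/-- Pass below a binder of a family variable. -/
def shiftFam (φ : Formula) : Formula := φ.subst var Nat.succ

/-- Replace the outermost thing variable (index `0`) by the term `t`. -/
def inst (φ : Formula) (t : Term) : Formula :=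
  φ.subst (scons t var) id

/-- Replace the outermost family variable (index `0`) by the family variable `k`. -/
def instFam (φ : Formula) (k : ℕ) : Formula :=
  φ.subst var (scons k id)

/-- Negation. -/
def neg (φ : Formula) : Formula := φ.imp bot
/-- Conjunction. -/
def and (φ ψ : Formula) : Formula := (φ.imp ψ.neg).neg
/-- Disjunction. -/
def or (φ ψ : Formula) : Formula := φ.neg.imp ψ
/-- Equivalence. -/
def iff (φ ψ : Formula) : Formula := (φ.imp ψ).and (ψ.imp φ)
/-- `∃ α, φ`. -/
def ex (φ : Formula) : Formula := φ.neg.all.neg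
/-- `∃ X, φ`. -/
def exSet (φ : Formula) : Formula := φ.neg.allSet.neg
/-- `∃ f_t, φ`. -/
def exFun (t : Term) (φ : Formula) : Formula := (allFun t φ.neg).neg
/-- `(∃ f_{ξ})_{ξ ∈ t} φ`. -/
def exFam (t : Term) (φ : Formula) : Formula := (allFam t φ.neg).neg
/-- `∃! α, φ`, that is, `∃ α, φ(α) ∧ ∀ β, φ(β) → β = α`. -/
def exUnique (φ : Formula) : Formula :=
  ex (φ.and (all
    ((φ.subst (scons (var 0) fun n => var (n + 2)) id).imp
      (eq (var 0) (var 1)))))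
/-- `∀ α ∈ t, φ` (the bound variable does not occur in `t`). -/
def allIn (t : Term) (φ : Formula) : Formula := all ((mem (var 0) t.shift).imp φ)
/-- `∃ α ∈ t, φ`. -/
def exIn (t : Term) (φ : Formula) : Formula := ex ((mem (var 0) t.shift).and φ)

/-- `t` is a set: `∃ X, X = t`. -/
def isSet (t : Term) : Formula := exSet (eq (var 0) t.shift)
/-- `g` is a function on `t`: `∃ f_t, f_t = g`. -/
def isFun (t g : Term) : Formula := exFun t (eq (var 0) g.shift)
/-- The `k`-th family is a family of ur-functions indexed in `t`: for every `ξ ∈ t`, its member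
`f_{ξ}` is a function on `{ξ}`. -/
def isFam (t : Term) (k : ℕ) : Formula :=
  allIn t (isFun (succ (var 0)) (fam k (var 0)))

/-- The standard formulas: no multiple quantifier and no conjunctive operator occurs. -/
def IsStandard : Formula → Prop
  | eq _ _ => True
  | mem _ _ => True
  | surj _ _ _ => True
  | maps _ _ _ => True
  | bot => True
  | imp φ ψ => φ.IsStandard ∧ ψ.IsStandard
  | all φ => φ.IsStandard
  | allSet φ => φ.IsStandard
  | allFun _ φ => φ.IsStandard
  | allFam _ _ => False
  | bigAnd _ _ _ => False

end Formula

open Formula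

/-- `Derives T Γ φ`: in the nonstandard logic, `φ` is derivable from the postulates in `T`, under
the hypotheses `Γ`. Free variables in members of `T` may be taken arbitrarily (a theory consists
of sentences and of schemata that are closed under substitution), free variables in `Γ` are
parameters. The calculus is classical natural deduction with equality, with a quantifier for
every sort of variables, and with the nonstandard rules at the end. -/
inductive Derives (T : Set Formula) : List Formula → Formula → Prop
  | ax {Γ φ} : φ ∈ T → Derives T Γ φ
  | hyp {Γ φ} : φ ∈ Γ → Derives T Γ φ
  | impI {Γ φ ψ} : Derives T (φ :: Γ) ψ → Derives T Γ (φ.imp ψ)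
  | impE {Γ φ ψ} : Derives T Γ (φ.imp ψ) → Derives T Γ φ → Derives T Γ ψ
  | raa {Γ φ} : Derives T (φ.neg :: Γ) bot → Derives T Γ φ
  | eqI {Γ} (t : Term) : Derives T Γ (eq t t)
  | eqE {Γ} (φ : Formula) (s t : Term) :
      Derives T Γ (eq s t) → Derives T Γ (φ.inst s) → Derives T Γ (φ.inst t)
  | allI {Γ φ} : Derives T (Γ.map shift) φ → Derives T Γ (all φ)
  | allE {Γ φ} (t : Term) : Derives T Γ (all φ) → Derives T Γ (φ.inst t)
  | allSetI {Γ φ} :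
      Derives T (isSet (var 0) :: Γ.map shift) φ → Derives T Γ (allSet φ)
  | allSetE {Γ φ} (t : Term) :
      Derives T Γ (allSet φ) → Derives T Γ (isSet t) → Derives T Γ (φ.inst t)
  | allFunI {Γ t φ} :
      Derives T (isFun t.shift (var 0) :: Γ.map shift) φ → Derives T Γ (allFun t φ)
  | allFunE {Γ t φ} (g : Term) :
      Derives T Γ (allFun t φ) → Derives T Γ (isFun t g) → Derives T Γ (φ.inst g)
  /-- All things are sets or functions. -/
  | thing {Γ} (t : Term) :
      Derives T Γ ((isSet t).or (exSet (isFun (var 0) t.shift)))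
  /-- `f(t)` denotes the unique `β` with `f : t ↦ β`, if there is one. -/
  | valI {Γ} (f t : Term) :
      Derives T Γ (exUnique (maps f.shift t.shift (var 0))) →
      Derives T Γ (maps f t (val f t))
  /-- Introduction of the multiple quantifier. -/
  | allFamI {Γ t φ} :
      Derives T (isFam t.shiftFam 0 :: Γ.map shiftFam) φ → Derives T Γ (allFam t φ)
  /-- Elimination of the multiple quantifier, for a given family. -/
  | allFamE {Γ t φ} (k : ℕ) :
      Derives T Γ (allFam t φ) → Derives T Γ (isFam t k) → Derives T Γ (φ.instFam k)
  /-- Formation of a family: if for every `ξ ∈ t` there is an ur-function `h_{ξ}` with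
  `φ(ξ, h_{ξ})`, then there is a family `(f_{ξ})_{ξ ∈ t}` with `φ(ξ, f_{ξ})` for all `ξ ∈ t`.
  In `φ`, index `0` is `h_{ξ}` and index `1` is `ξ`. -/
  | exFamI {Γ} (t : Term) (φ : Formula) :
      Derives T Γ (allIn t (exFun (succ (var 0)) φ)) →
      Derives T Γ (exFam t (allIn t.shiftFam
        (φ.subst (scons (fam 0 (var 0)) var) Nat.succ)))
  /-- Introduction of the conjunctive operator, from the formulas `F : ξ ↦ f_{ξ}(ξ)` for
  arbitrary `ξ ∈ t`. -/
  | bigAndI {Γ} (t F : Term) (k : ℕ) :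
      Derives T (mem (var 0) t.shift :: Γ.map shift)
        (maps F.shift (var 0) (val (fam k (var 0)) (var 0))) →
      Derives T Γ (bigAnd t F k)
  /-- Elimination of the conjunctive operator. -/
  | bigAndE {Γ} (t F : Term) (k : ℕ) (s : Term) :
      Derives T Γ (bigAnd t F k) → Derives T Γ (mem s t) →
      Derives T Γ (maps F s (val (fam k s) s))

/-- `T ⊩ φ`: derivability in the nonstandard logic. -/
def Entails (T : Set Formula) (φ : Formula) : Prop := Derives T [] φ

/-- Consistency in the nonstandard logic. -/
def Consistent (T : Set Formula) : Prop := ¬ Entails T bot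

/-! The set-theoretical postulates. -/

/-- `∀ X ∀ Y (X = Y ⇔ ∀ α (α ∈ X ⇔ α ∈ Y))` -/
def extensionality : Formula :=
  allSet (allSet ((eq (var 1) (var 0)).iff
    (all ((mem (var 0) (var 2)).iff (mem (var 0) (var 1))))))

/-- `∀ X ∀ f_X ∀ Y (f_X ≠ Y)` -/
def functionsNotSets : Formula :=
  allSet (allFun (var 0) (allSet (eq (var 1) (var 0)).neg))

/-- `∀ X ∀ α ∀ β (¬ X : α ↠ β ∧ ¬ X : α ↦ β)` -/
def setsInactive : Formula :=
  allSet (all (all ((surj (var 2) (var 1) (var 0)).neg.and (maps (var 2) (var 1) (var 0)).neg)))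

/-- `∃ X (X = ∅ ∧ ∀ α (α ∉ X))` -/
def emptySet : Formula :=
  exSet ((eq (var 0) empty).and (all (mem (var 0) (var 1)).neg))

/-- `∀ α ∀ β ∃ X ∀ γ (γ ∈ X ⇔ γ = α ∨ γ = β)` -/
def pairing : Formula :=
  all (all (exSet (all ((mem (var 0) (var 1)).iff
    ((eq (var 0) (var 3)).or (eq (var 0) (var 2)))))))

/-- `∀ X ∃ Y ∀ α (α ∈ Y ⇔ ∃ Z (Z ∈ X ∧ α ∈ Z))` -/
def unionSet : Formula :=
  allSet (exSet (all ((mem (var 0) (var 1)).iff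
    (exSet ((mem (var 0) (var 3)).and (mem (var 1) (var 0)))))))

/-- `∀ X ∃ Y ∀ α (α ∈ Y ⇔ ∃ Z (Z ⊆ X ∧ α = Z))` -/
def powerSet : Formula :=
  allSet (exSet (all ((mem (var 0) (var 1)).iff
    (exSet ((allIn (var 0) (mem (var 0) (var 4))).and (eq (var 1) (var 0)))))))

/-- `∀ X ≠ ∅ ∃ α (α ∈ X ∧ ∀ β (β ∈ α ⇒ β ∉ X))` -/
def regularity : Formula :=
  allSet ((eq (var 0) empty).neg.imp
    (ex ((mem (var 0) (var 1)).and (all ((mem (var 0) (var 1)).imp (mem (var 0) (var 2)).neg)))))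

/-- `∃ X (X = ω ∧ ∅ ∈ ω ∧ ∀ α (α ∈ ω ⇒ α⁺ ∈ ω) ∧ ∀ β ∈ ω (¬ ∃ γ ∈ ω (β = γ⁺) ⇔ β = ∅))` -/
def infiniteSet : Formula :=
  exSet ((eq (var 0) omega).and ((mem empty omega).and
    ((all ((mem (var 0) omega).imp (mem (succ (var 0)) omega))).and
      (allIn omega ((exIn omega (eq (var 1) (succ (var 0)))).neg.iff (eq (var 0) empty))))))

/-- `∀ α ∀ β (β = α⁺ ⇔ ∃ X (β = X ∧ ∀ γ (γ ∈ X ⇔ γ = α)))` -/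
def successor : Formula :=
  all (all ((eq (var 0) (succ (var 1))).iff
    (exSet ((eq (var 1) (var 0)).and
      (all ((mem (var 0) (var 1)).iff (eq (var 0) (var 3))))))))

/-! The standard function-theoretical postulates. -/

/-- `∀ X ∀ f_X ∀ α (α ∉ f_X)` -/
def functionsNoElements : Formula :=
  allSet (allFun (var 0) (all (mem (var 0) (var 1)).neg))

/-- `∀ X ∀ f_X (X ≠ ∅ ⇒ ∃ Y ∃ Z (f_X : Y ↠ Z ∧ ∀ α ∈ Y ∃! β (f_X : α ↦ β)))` -/
def functionsAct : Formula :=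
  allSet (allFun (var 0) ((eq (var 1) empty).neg.imp
    (exSet (exSet ((surj (var 2) (var 1) (var 0)).and
      (allIn (var 1) (exUnique (maps (var 4) (var 1) (var 0)))))))))

/-- `∀ X ∀ f_X ∀ α (α ≠ X ⇒ ∀ ξ (¬ f_X : α ↠ ξ))` -/
def uniqueDomain : Formula :=
  allSet (allFun (var 0) (all ((eq (var 0) (var 2)).neg.imp
    (all (surj (var 2) (var 1) (var 0)).neg))))

/-- `∀ X ∀ f_X ∀ α ∉ X ∀ β (¬ f_X : α ↦ β)` -/
def noActionOutside : Formula :=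
  allSet (allFun (var 0) (all ((mem (var 0) (var 2)).neg.imp
    (all (maps (var 2) (var 1) (var 0)).neg))))

/-- `∀ X ∀ f_X (X ≠ ∅ ⇒ ∀ β (f_X : X ↠ β ⇒
  ∃ Z (β = Z ∧ ∀ γ (γ ∈ Z ⇔ ∃ η ∈ X (f_X : η ↦ γ)))))` -/
def imageSet : Formula :=
  allSet (allFun (var 0) ((eq (var 1) empty).neg.imp
    (all ((surj (var 1) (var 2) (var 0)).imp
      (exSet ((eq (var 1) (var 0)).and
        (all ((mem (var 0) (var 1)).iff
          (exIn (var 4) (maps (var 4) (var 0) (var 1)))))))))))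

/-- `∀ X ≠ ∅ ∀ f_X ∀ Y (f_X : X ↠ Y ⇒ ∀ β ∃ Z ∀ α (α ∈ Z ⇔ α ∈ X ∧ f_X : α ↦ β))` -/
def inverseImageSet : Formula :=
  allSet ((eq (var 0) empty).neg.imp (allFun (var 0) (allSet
    ((surj (var 1) (var 2) (var 0)).imp
      (all (exSet (all ((mem (var 0) (var 1)).iff
        ((mem (var 0) (var 5)).and (maps (var 4) (var 0) (var 2)))))))))))

/-- `∃ f_∅ (f_∅ = 1_∅ ∧ f_∅ : ∅ ↠ ∅ ∧ ∀ α ∀ β (¬ f_∅ : α ↦ β))` -/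
def inactiveFunction : Formula :=
  exFun empty ((eq (var 0) inactive).and ((surj (var 0) empty empty).and
    (all (all (maps (var 2) (var 1) (var 0)).neg))))

/-- `∀ α ∀ β ∃ f_{α⁺} (f_{α⁺} : α⁺ ↠ β⁺ ∧ f_{α⁺} : α ↦ β)` -/
def urFunction : Formula :=
  all (all (exFun (succ (var 1))
    ((surj (var 0) (succ (var 2)) (succ (var 1))).and (maps (var 0) (var 2) (var 1)))))

/-- `∀ X ∀ f_X ∀ Y (f_X : X ↠ Y ⇒ ∀ α (¬ f_X : f_X ↦ α ∧ ¬ f_X : α ↦ f_X))` -/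
def functionRegularity : Formula :=
  allSet (allFun (var 0) (allSet ((surj (var 1) (var 2) (var 0)).imp
    (all ((maps (var 2) (var 2) (var 0)).neg.and (maps (var 2) (var 0) (var 2)).neg)))))

/-- The standard postulates. -/
def basicPostulates : Set Formula :=
  {extensionality, functionsNotSets, setsInactive, emptySet, pairing, unionSet, powerSet,
    regularity, infiniteSet, successor, functionsNoElements, functionsAct, uniqueDomain,
    noActionOutside, imageSet, inverseImageSet, inactiveFunction, urFunction,
    functionRegularity}

/-! The collection `Γ` of standard formulas: separation, replacement, reverse graph. -/

/-- `∀ X ∃ Y ∀ α (α ∈ Y ⇔ α ∈ X ∧ φ(α))`. In `φ`, index `0` is `α`, index `1` is `X`, and the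
other variables are parameters. -/
def separation (φ : Formula) : Formula :=
  allSet (exSet (all ((mem (var 0) (var 1)).iff ((mem (var 0) (var 2)).and
    (φ.subst (scons (var 0) fun n => var (n + 2)) id)))))

/-- `∀ X (∀ α ∈ X ∃! β ψ(α, β) ⇒ ∃ Z ∀ γ (γ ∈ Z ⇔ ∃ ξ (ξ ∈ X ∧ ψ(ξ, γ))))`. In `ψ`, index `0`
is `β`, index `1` is `α`, index `2` is `X`, and the other variables are parameters. -/
def replacement (ψ : Formula) : Formula :=
  allSet ((allIn (var 0) (exUnique ψ)).imp
    (exSet (all ((mem (var 0) (var 1)).iff (exIn (var 2)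
      (ψ.subst (scons (var 1) (scons (var 0) fun n => var (n + 3))) id))))))

/-- `t` is the set `{a, b}`. -/
def isPairSet (t a b : Term) : Formula :=
  (isSet t).and (all ((mem (var 0) t.shift).iff
    ((eq (var 0) a.shift).or (eq (var 0) b.shift))))

/-- `t` is the two-tuple `(a, b) = {a, {a, b}}`. -/
def isTuple (t a b : Term) : Formula :=
  ex ((isPairSet (var 0) a.shift b.shift).and (isPairSet t.shift a.shift (var 0)))

/-- `(a, b) ∈ g`. -/
def tupleMem (a b g : Term) : Formula :=
  exIn g (isTuple (var 0) a.shift b.shift)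

/-- `g ∈ Y ^ X`: the set `g` is the graph of a function from `X` to `Y`, i.e. every element of `g`
is a two-tuple `(α, β)` with `α ∈ X` and `β ∈ Y`, and for every `α ∈ X` there is exactly one `β`
with `(α, β) ∈ g`. -/
def isGraph (g X Y : Term) : Formula :=
  (isSet g).and
    ((allIn g (exIn X.shift (exIn Y.shift.shift (isTuple (var 2) (var 1) (var 0))))).and
      (allIn X (exUnique (tupleMem (var 1) (var 0) g.shift.shift))))

/-- `∀ f ∀ X ∀ Y (f ∈ Y ^ X ⇒ ∃ h_X ∀ α ∀ β (h_X : α ↦ β ⇔ (α, β) ∈ f))` -/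
def reverseGraph : Formula :=
  allSet (allSet (allSet ((isGraph (var 2) (var 1) (var 0)).imp
    (exFun (var 1) (all (all
      ((maps (var 2) (var 1) (var 0)).iff (tupleMem (var 1) (var 0) (var 5)))))))))

/-- The theory `𝔗^∞_0`: the standard postulates, all instances of separation and replacement for
standard formulas, and reverse graph. -/
def theoryT0 : Set Formula :=
  basicPostulates ∪ {χ | ∃ φ : Formula, φ.IsStandard ∧ χ = separation φ} ∪
    {χ | ∃ ψ : Formula, ψ.IsStandard ∧ χ = replacement ψ} ∪ {reverseGraph}

/-- The sum function postulate
`∀ X (∀ f_{ξ})_{ξ ∈ X} ∃ F_X ∃ Y [F_X : X ↠ Y ∧ ⋀_{ξ ∈ X} F_X : ξ ↦ f_{ξ}(ξ)]`. -/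
def sumF : Formula :=
  allSet (allFam (var 0) (exFun (var 0) (exSet
    ((surj (var 1) (var 2) (var 0)).and (bigAnd (var 2) (var 1) 0)))))

/-- The theory `𝔗`: the standard postulates and the sum function postulate. -/
def theoryT : Set Formula := basicPostulates ∪ {sumF}

end FunSet

/-!
A theory that is valid in some structure is consistent, because the nonstandard rules are sound for
every structure in which a family variable ranges over arbitrary maps from things to things: the
formation of families is then the axiom of choice. Inside ZFC, let a set of things be coded by a
pair `(∅, x)` and a function by a pair `({∅}, g)` with `g` its graph, hereditarily. In this universe
every small class of things is a set and every map restricts to a function on every set, so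
separation, replacement and reverse graph hold for all properties whatsoever, and the sum of a
family `(f_{ξ})_{ξ ∈ X}` is the restriction to `X` of the map `ξ ↦ f_{ξ}(ξ)`.
-/

namespace FunSet

theorem Derives.mono {T T' : Set Formula} (hT : T ⊆ T') {Γ : List Formula} {φ : Formula}
    (h : Derives T Γ φ) : Derives T' Γ φ := by
  induction h with
  | ax h => exact .ax (hT h)
  | hyp h => exact .hyp h
  | impI _ ih => exact .impI ih
  | impE _ _ ih₁ ih₂ => exact .impE ih₁ ih₂
  | raa _ ih => exact .raa ih
  | eqI t => exact .eqI t
  | eqE φ s t _ _ ih₁ ih₂ => exact .eqE φ s t ih₁ ih₂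
  | allI _ ih => exact .allI ih
  | allE t _ ih => exact .allE t ih
  | allSetI _ ih => exact .allSetI ih
  | allSetE t _ _ ih₁ ih₂ => exact .allSetE t ih₁ ih₂
  | allFunI _ ih => exact .allFunI ih
  | allFunE g _ _ ih₁ ih₂ => exact .allFunE g ih₁ ih₂
  | thing t => exact .thing t
  | valI f t _ ih => exact .valI f t ih
  | allFamI _ ih => exact .allFamI ih
  | allFamE k _ _ ih₁ ih₂ => exact .allFamE k ih₁ ih₂
  | exFamI t φ _ ih => exact .exFamI t φ ih
  | bigAndI t F k _ ih => exact .bigAndI t F k ih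
  | bigAndE t F k s _ _ ih₁ ih₂ => exact .bigAndE t F k s ih₁ ih₂

theorem Consistent.mono {T T' : Set Formula} (hT : T ⊆ T') (h : Consistent T') : Consistent T :=
  fun hbot => h (Derives.mono hT hbot)

theorem Consistent.not_entails_neg {T : Set Formula} {φ : Formula} (h : Consistent (T ∪ {φ})) :
    ¬ Entails T φ.neg :=
  fun hφ => h (.impE (Derives.mono Set.subset_union_left hφ) (.ax (Or.inr rfl)))

/-! ### Semantics -/

/-- A structure for the language of sets and functions: an interpretation of its primitive notions
in a universe `M` of things, subject only to what the rules of the calculus presuppose. The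
elements of a thing `x` are given as the set `elems x`, and `IsFunOn t g` says that `g` is one of
the values of the composite variable `f_t`. -/
class Structure (M : Type*) where
  IsSet : M → Prop
  IsFunOn : M → M → Prop
  elems : M → Set M
  Surj : M → M → M → Prop
  Maps : M → M → M → Prop
  empty : M
  omega : M
  inactive : M
  single : M → M
  app : M → M → M
  isSet_or_isFunOn (x : M) : IsSet x ∨ ∃ t, IsSet t ∧ IsFunOn t x
  maps_app {f a : M} : (∃! b, Maps f a b) → Maps f a (app f a)

/-- The valuation `a, v 0, v 1, …`: the counterpart of `scons` in a universe of any size. -/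
def push {α : Type*} (a : α) (v : ℕ → α) : ℕ → α
  | 0 => a
  | n + 1 => v n

theorem apply_scons {α : Type} {β : Type*} (f : α → β) (a : α) (s : ℕ → α) :
    (fun n => f (scons a s n)) = push (f a) fun n => f (s n) := by
  funext n
  cases n <;> rfl

theorem push_upFam {α : Type*} (a : α) (v : ℕ → α) (ρ : ℕ → ℕ) :
    (fun k => push a v (upFam ρ k)) = push a fun k => v (ρ k) := by
  funext k
  cases k <;> rfl

section Semantics

variable {M : Type*} [Structure M]

/-- The value of a term, when the thing variables have the values `v` and the family variables have
the values `F`. -/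
def Term.eval (v : ℕ → M) (F : ℕ → M → M) : Term → M
  | .var n => v n
  | .empty => Structure.empty
  | .omega => Structure.omega
  | .inactive => Structure.inactive
  | .succ t => Structure.single (t.eval v F)
  | .fam k t => F k (t.eval v F)
  | .val f t => Structure.app (f.eval v F) (t.eval v F)

/-- Truth of a formula in a structure. The value of a family variable is an arbitrary map `M → M`,
of which only the values at the indices of the family matter. -/
def Formula.Sat : Formula → (ℕ → M) → (ℕ → M → M) → Prop
  | eq s t, v, F => s.eval v F = t.eval v F
  | mem s t, v, F => s.eval v F ∈ Structure.elems (t.eval v F)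
  | surj f s t, v, F => Structure.Surj (f.eval v F) (s.eval v F) (t.eval v F)
  | maps f s t, v, F => Structure.Maps (f.eval v F) (s.eval v F) (t.eval v F)
  | bot, _, _ => False
  | imp φ ψ, v, F => φ.Sat v F → ψ.Sat v F
  | all φ, v, F => ∀ x, φ.Sat (push x v) F
  | allSet φ, v, F => ∀ x, Structure.IsSet x → φ.Sat (push x v) F
  | allFun t φ, v, F => ∀ g, Structure.IsFunOn (t.eval v F) g → φ.Sat (push g v) F
  | allFam t φ, v, F => ∀ G : M → M,
      (∀ ξ ∈ Structure.elems (t.eval v F), Structure.IsFunOn (Structure.single ξ) (G ξ)) →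
        φ.Sat v (push G F)
  | bigAnd t f k, v, F => ∀ ξ ∈ Structure.elems (t.eval v F),
      Structure.Maps (f.eval v F) ξ (Structure.app (F k ξ) ξ)

variable (M) in
/-- Validity in the structure `M`: truth for all values of the free variables. -/
def Valid (φ : Formula) : Prop := ∀ (v : ℕ → M) (F : ℕ → M → M), φ.Sat v F

variable (v : ℕ → M) (F : ℕ → M → M)

theorem Term.eval_subst (t : Term) (σ : ℕ → Term) (ρ : ℕ → ℕ) :
    (t.subst σ ρ).eval v F = t.eval (fun n => (σ n).eval v F) (fun k => F (ρ k)) := by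
  induction t <;> simp_all [Term.subst, Term.eval]

@[simp] theorem Term.eval_shift (t : Term) (x : M) : t.shift.eval (push x v) F = t.eval v F :=
  t.eval_subst ..

@[simp] theorem Term.eval_shiftFam (t : Term) (G : M → M) :
    t.shiftFam.eval v (push G F) = t.eval v F :=
  t.eval_subst ..

theorem eval_up (σ : ℕ → Term) (x : M) :
    (fun n => (up σ n).eval (push x v) F) = push x fun n => (σ n).eval v F := by
  funext n
  cases n with
  | zero => rfl
  | succ n => exact (σ n).eval_shift v F x

theorem eval_scons (t : Term) (σ : ℕ → Term) :
    (fun n => (scons t σ n).eval v F) = push (t.eval v F) fun n => (σ n).eval v F :=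
  apply_scons (Term.eval v F) t σ

namespace Formula

theorem sat_subst (φ : Formula) (σ : ℕ → Term) (ρ : ℕ → ℕ) :
    (φ.subst σ ρ).Sat v F ↔ φ.Sat (fun n => (σ n).eval v F) (fun k => F (ρ k)) := by
  induction φ generalizing σ ρ v F <;>
    simp_all [Formula.subst, Sat, Term.eval_subst, eval_up, push_upFam]

variable (φ ψ : Formula) (s t : Term)

@[simp] theorem sat_shift (x : M) : φ.shift.Sat (push x v) F ↔ φ.Sat v F :=
  φ.sat_subst ..

@[simp] theorem sat_shiftFam (G : M → M) : φ.shiftFam.Sat v (push G F) ↔ φ.Sat v F :=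
  φ.sat_subst ..

@[simp] theorem sat_inst : (φ.inst t).Sat v F ↔ φ.Sat (push (t.eval v F) v) F := by
  rw [inst, sat_subst, eval_scons]
  rfl

@[simp] theorem sat_instFam (k : ℕ) : (φ.instFam k).Sat v F ↔ φ.Sat v (push (F k) F) := by
  rw [instFam, sat_subst, apply_scons]
  rfl

@[simp] theorem sat_neg : φ.neg.Sat v F ↔ ¬ φ.Sat v F := Iff.rfl

@[simp] theorem sat_and : (φ.and ψ).Sat v F ↔ φ.Sat v F ∧ ψ.Sat v F := by
  simp [Formula.and, Sat]

@[simp] theorem sat_or : (φ.or ψ).Sat v F ↔ φ.Sat v F ∨ ψ.Sat v F := by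
  simp [Formula.or, Sat, or_iff_not_imp_left]

@[simp] theorem sat_iff : (φ.iff ψ).Sat v F ↔ (φ.Sat v F ↔ ψ.Sat v F) := by
  simp [Formula.iff, Sat, iff_iff_implies_and_implies]

@[simp] theorem sat_ex : (ex φ).Sat v F ↔ ∃ x, φ.Sat (push x v) F := by
  simp [ex, Sat]

@[simp] theorem sat_exSet :
    (exSet φ).Sat v F ↔ ∃ x, Structure.IsSet x ∧ φ.Sat (push x v) F := by
  simp [exSet, Sat]

@[simp] theorem sat_exFun :
    (exFun t φ).Sat v F ↔ ∃ g, Structure.IsFunOn (t.eval v F) g ∧ φ.Sat (push g v) F := by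
  simp [exFun, Sat]

@[simp] theorem sat_exFam : (exFam t φ).Sat v F ↔ ∃ G : M → M,
    (∀ ξ ∈ Structure.elems (t.eval v F), Structure.IsFunOn (Structure.single ξ) (G ξ)) ∧
      φ.Sat v (push G F) := by
  simp [exFam, Sat]

@[simp] theorem sat_exUnique : (exUnique φ).Sat v F ↔ ∃! x, φ.Sat (push x v) F := by
  simp only [exUnique, sat_ex, sat_and, Sat, sat_subst, eval_scons]
  rfl

@[simp] theorem sat_allIn :
    (allIn t φ).Sat v F ↔ ∀ x ∈ Structure.elems (t.eval v F), φ.Sat (push x v) F := by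
  simp [allIn, Sat, Term.eval, push]

@[simp] theorem sat_exIn :
    (exIn t φ).Sat v F ↔ ∃ x ∈ Structure.elems (t.eval v F), φ.Sat (push x v) F := by
  simp [exIn, Sat, Term.eval, push]

@[simp] theorem sat_isSet : (isSet t).Sat v F ↔ Structure.IsSet (t.eval v F) := by
  simp [isSet, Sat, Term.eval, push]

@[simp] theorem sat_isFun :
    (isFun s t).Sat v F ↔ Structure.IsFunOn (s.eval v F) (t.eval v F) := by
  simp [isFun, Sat, Term.eval, push]

@[simp] theorem sat_isFam (k : ℕ) : (isFam t k).Sat v F ↔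
    ∀ ξ ∈ Structure.elems (t.eval v F), Structure.IsFunOn (Structure.single ξ) (F k ξ) := by
  simp [isFam, Term.eval, push]

end Formula

open Formula

theorem sat_thing (t : Term) : ((isSet t).or (exSet (isFun (.var 0) t.shift))).Sat v F := by
  simpa [Term.eval, push] using Structure.isSet_or_isFunOn (t.eval v F)

theorem sat_maps_val {v : ℕ → M} {F : ℕ → M → M} {f t : Term}
    (h : (exUnique (maps f.shift t.shift (.var 0))).Sat v F) :
    (maps f t (.val f t)).Sat v F :=
  Structure.maps_app (by simpa [Sat, Term.eval, push] using h)

theorem sat_exFam_of_sat_allIn {v : ℕ → M} {F : ℕ → M → M} {t : Term} {φ : Formula}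
    (h : (allIn t (exFun (.succ (.var 0)) φ)).Sat v F) :
    (exFam t (allIn t.shiftFam (φ.subst (scons (.fam 0 (.var 0)) .var) Nat.succ))).Sat v F := by
  have : Nonempty M := ⟨Structure.empty⟩
  simp only [sat_allIn, sat_exFun] at h
  choose! G hG hφ using h
  simp only [sat_exFam, sat_allIn, Term.eval_shiftFam, sat_subst, eval_scons]
  exact ⟨G, hG, hφ⟩

theorem Derives.sat {T : Set Formula} (hT : ∀ φ ∈ T, Valid M φ) {Γ : List Formula} {φ : Formula}
    (h : Derives T Γ φ) {v : ℕ → M} {F : ℕ → M → M} (hΓ : ∀ γ ∈ Γ, γ.Sat v F) : φ.Sat v F := by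
  induction h generalizing v F with
  | ax h => exact hT _ h v F
  | hyp h => exact hΓ _ h
  | impI _ ih => exact fun hφ => ih (List.forall_mem_cons.2 ⟨hφ, hΓ⟩)
  | impE _ _ ih₁ ih₂ => exact ih₁ hΓ (ih₂ hΓ)
  | raa _ ih => exact by_contra fun hφ => ih (List.forall_mem_cons.2 ⟨hφ, hΓ⟩)
  | eqI t => exact rfl
  | eqE φ s t _ _ ih₁ ih₂ =>
    have hst : s.eval v F = t.eval v F := ih₁ hΓ
    exact (sat_inst ..).2 (hst ▸ (sat_inst ..).1 (ih₂ hΓ))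
  | allI _ ih => exact fun x => ih (by simpa using hΓ)
  | allE t _ ih => exact (sat_inst ..).2 (ih hΓ _)
  | allSetI _ ih => exact fun x hx => ih (by simpa [Term.eval, push] using ⟨hx, hΓ⟩)
  | allSetE t _ _ ih₁ ih₂ => exact (sat_inst ..).2 (ih₁ hΓ _ ((sat_isSet ..).1 (ih₂ hΓ)))
  | allFunI _ ih => exact fun g hg => ih (by simpa [Term.eval, push] using ⟨hg, hΓ⟩)
  | allFunE g _ _ ih₁ ih₂ => exact (sat_inst ..).2 (ih₁ hΓ _ ((sat_isFun ..).1 (ih₂ hΓ)))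
  | thing t => exact sat_thing v F t
  | valI f t _ ih => exact sat_maps_val (ih hΓ)
  | allFamI _ ih => exact fun G hG => ih (by simpa [push] using ⟨hG, hΓ⟩)
  | allFamE k _ _ ih₁ ih₂ => exact (sat_instFam ..).2 (ih₁ hΓ _ ((sat_isFam ..).1 (ih₂ hΓ)))
  | exFamI t φ _ ih => exact sat_exFam_of_sat_allIn (ih hΓ)
  | bigAndI _ _ _ _ ih =>
    intro ξ hξ
    have h := ih (v := push ξ v) (F := F) (by simpa [Sat, Term.eval, push] using ⟨hξ, hΓ⟩)
    simpa [Sat, Term.eval, push] using h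
  | bigAndE _ _ _ _ _ _ ih₁ ih₂ => exact ih₁ hΓ _ (ih₂ hΓ)

variable (M) in
theorem consistent_of_valid {T : Set Formula} (hT : ∀ φ ∈ T, Valid M φ) : Consistent T :=
  fun h => Derives.sat hT h (v := fun _ => Structure.empty) (F := fun _ => id)
    fun _ hγ => absurd hγ List.not_mem_nil

end Semantics

/-! ### A universe of sets and functions -/

universe u

theorem singleton_empty_ne_empty : ({∅} : ZFSet.{u}) ≠ ∅ := fun h =>
  (ZFSet.eq_empty _).1 h ∅ (ZFSet.mem_singleton.2 rfl)

/-- The codes of sets and functions in ZFC: `(∅, x)` codes the set of the things coded by the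
elements of `x`, and `({∅}, g)` codes the function with graph `g`. -/
inductive IsThing : ZFSet.{u} → Prop
  | set {x : ZFSet} : (∀ z ∈ x, IsThing z) → IsThing (ZFSet.pair ∅ x)
  | fn {x y g : ZFSet} : ZFSet.IsFunc x y g → (∀ a ∈ x, IsThing a) → (∀ b ∈ y, IsThing b) →
      IsThing (ZFSet.pair {∅} g)

theorem IsThing.of_mem {x z : ZFSet.{u}} (h : IsThing (ZFSet.pair ∅ x)) (hz : z ∈ x) :
    IsThing z := by
  generalize hp : ZFSet.pair ∅ x = p at h
  cases h with
  | set hx => exact hx z ((ZFSet.pair_inj.1 hp).2 ▸ hz)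
  | fn => exact absurd (ZFSet.pair_inj.1 hp).1.symm singleton_empty_ne_empty

theorem IsThing.eq_of_pair_mem {g a b c : ZFSet.{u}} (h : IsThing (ZFSet.pair {∅} g))
    (hb : ZFSet.pair a b ∈ g) (hc : ZFSet.pair a c ∈ g) : b = c := by
  generalize hp : ZFSet.pair {∅} g = p at h
  cases h with
  | set => exact absurd (ZFSet.pair_inj.1 hp).1 singleton_empty_ne_empty
  | fn hg =>
    obtain rfl := (ZFSet.pair_inj.1 hp).2
    exact (hg.2 a (ZFSet.pair_mem_prod.1 (hg.1 hb)).1).unique hb hc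

/-- The universe of sets and functions. -/
def Thing : Type (u + 1) := {z : ZFSet.{u} // IsThing z}

namespace Thing

/-- `x` is a set. -/
def IsSet (x : Thing.{u}) : Prop := ∃ s, x.1 = ZFSet.pair ∅ s

/-- `x` is a function. -/
def IsFn (x : Thing.{u}) : Prop := ∃ g, x.1 = ZFSet.pair {∅} g

/-- The elements of a set; functions have none. -/
def elems (x : Thing.{u}) : Set Thing.{u} := {y | ∃ s, x.1 = ZFSet.pair ∅ s ∧ y.1 ∈ s}

/-- `f : a ↦ b`. -/
def Maps (f a b : Thing.{u}) : Prop := ∃ g, f.1 = ZFSet.pair {∅} g ∧ ZFSet.pair a.1 b.1 ∈ g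

/-- The domain of a function; it is empty for sets. -/
def dom (f : Thing.{u}) : Set Thing.{u} := {a | ∃ b, f.Maps a b}

/-- The set of values of a function; it is empty for sets. -/
def range (f : Thing.{u}) : Set Thing.{u} := {b | ∃ a, f.Maps a b}

/-- `f` is a function on the set `t`. -/
def IsFunOn (t f : Thing.{u}) : Prop := f.IsFn ∧ t.IsSet ∧ f.dom = t.elems

theorem isSet_or_isFn (x : Thing.{u}) : x.IsSet ∨ x.IsFn := by
  obtain ⟨_, h⟩ := x
  cases h with
  | set => exact .inl ⟨_, rfl⟩
  | fn => exact .inr ⟨_, rfl⟩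

theorem IsFn.not_isSet {x : Thing.{u}} : x.IsFn → ¬ x.IsSet := by
  rintro ⟨g, hg⟩ ⟨s, hs⟩
  exact singleton_empty_ne_empty (ZFSet.pair_inj.1 (hg.symm.trans hs)).1

theorem isSet_of_mem_elems {x y : Thing.{u}} : y ∈ x.elems → x.IsSet :=
  fun ⟨s, hs, _⟩ => ⟨s, hs⟩

theorem Maps.isFn {f a b : Thing.{u}} : f.Maps a b → f.IsFn :=
  fun ⟨g, hg, _⟩ => ⟨g, hg⟩

theorem Maps.unique {f a b c : Thing.{u}} : f.Maps a b → f.Maps a c → b = c := by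
  rintro ⟨g, hg, hb⟩ ⟨g', hg', hc⟩
  obtain rfl := (ZFSet.pair_inj.1 (hg.symm.trans hg')).2
  exact Subtype.ext (IsThing.eq_of_pair_mem (hg ▸ f.2) hb hc)

theorem IsSet.eq_of_elems_eq {x y : Thing.{u}} (hx : x.IsSet) (hy : y.IsSet)
    (h : x.elems = y.elems) : x = y := by
  obtain ⟨s, hs⟩ := hx
  obtain ⟨t, ht⟩ := hy
  have mem_elems_iff {x : Thing} {s : ZFSet} (hs : x.1 = ZFSet.pair ∅ s) (z : Thing) :
      z ∈ x.elems ↔ z.1 ∈ s :=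
    ⟨fun ⟨s', hs', hz⟩ => (ZFSet.pair_inj.1 (hs.symm.trans hs')).2 ▸ hz, fun hz => ⟨s, hs, hz⟩⟩
  have hst (z : Thing) : z.1 ∈ s ↔ z.1 ∈ t := by
    rw [← mem_elems_iff hs, ← mem_elems_iff ht, h]
  suffices s = t from Subtype.ext (by rw [hs, ht, this])
  exact ZFSet.ext fun z => ⟨fun hz => (hst ⟨z, (hs ▸ x.2 : IsThing _).of_mem hz⟩).1 hz,
    fun hz => (hst ⟨z, (ht ▸ y.2 : IsThing _).of_mem hz⟩).2 hz⟩

/-! ### Rank and smallness -/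

theorem rank_left_lt_rank_pair (a b : ZFSet.{u}) : a.rank < (ZFSet.pair a b).rank :=
  (ZFSet.rank_lt_of_mem (ZFSet.mem_singleton.2 rfl)).trans
    (ZFSet.rank_lt_of_mem (ZFSet.mem_pair.2 (.inl rfl)))

theorem rank_right_lt_rank_pair (a b : ZFSet.{u}) : b.rank < (ZFSet.pair a b).rank :=
  (ZFSet.rank_lt_of_mem (ZFSet.mem_pair.2 (.inr rfl))).trans
    (ZFSet.rank_lt_of_mem (ZFSet.mem_pair.2 (.inr rfl)))

/-- The rank of a thing is the rank of its code: it is larger than the ranks of the elements of a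
set, and than those of the arguments and the values of a function. -/
noncomputable def rank (x : Thing.{u}) : Ordinal.{u} := x.1.rank

theorem rank_lt_of_mem_elems {x y : Thing.{u}} : y ∈ x.elems → y.rank < x.rank := by
  rintro ⟨s, hs, hy⟩
  rw [rank, rank, hs]
  exact (ZFSet.rank_lt_of_mem hy).trans (rank_right_lt_rank_pair ..)

theorem Maps.rank_pair_lt {f a b : Thing.{u}} :
    f.Maps a b → (ZFSet.pair a.1 b.1).rank < f.rank := by
  rintro ⟨g, hg, hab⟩
  rw [rank, hg]
  exact (ZFSet.rank_lt_of_mem hab).trans (rank_right_lt_rank_pair ..)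

theorem Maps.rank_left_lt {f a b : Thing.{u}} (h : f.Maps a b) : a.rank < f.rank :=
  (rank_left_lt_rank_pair ..).trans h.rank_pair_lt

theorem Maps.rank_right_lt {f a b : Thing.{u}} (h : f.Maps a b) : b.rank < f.rank :=
  (rank_right_lt_rank_pair ..).trans h.rank_pair_lt

theorem exists_minimal_mem {S : Set Thing.{u}} (hS : S.Nonempty) :
    ∃ x ∈ S, ∀ y ∈ x.elems, y ∉ S := by
  obtain ⟨x, hx, hmin⟩ := WellFounded.has_min (InvImage.wf rank wellFounded_lt) S hS
  exact ⟨x, hx, fun y hy hyS => hmin y hyS (rank_lt_of_mem_elems hy)⟩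

theorem small_of_rank_lt {S : Set Thing.{u}} {o : Ordinal.{u}} (hS : ∀ x ∈ S, x.rank < o) :
    Small.{u} S :=
  small_of_injective (β := ZFSet.vonNeumann o)
    (f := fun x => ⟨x.1.1, ZFSet.mem_vonNeumann.2 (hS x.1 x.2)⟩)
    fun _ _ h => Subtype.ext (Subtype.ext (Subtype.mk.inj h))

instance small_elems (x : Thing.{u}) : Small.{u} x.elems :=
  small_of_rank_lt fun _ => rank_lt_of_mem_elems

instance small_dom (f : Thing.{u}) : Small.{u} f.dom :=
  small_of_rank_lt fun _ ⟨_, h⟩ => h.rank_left_lt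

instance small_range (f : Thing.{u}) : Small.{u} f.range :=
  small_of_rank_lt fun _ ⟨_, h⟩ => h.rank_right_lt

instance small_subsets (x : Thing.{u}) : Small.{u} {y : Thing.{u} | y.IsSet ∧ y.elems ⊆ x.elems} :=
  small_of_injective (β := 𝒫 x.elems) (f := fun y => ⟨y.1.elems, y.2.2⟩)
    fun y z h => Subtype.ext (y.2.1.eq_of_elems_eq z.2.1 (congrArg Subtype.val h))

/-! ### Construction of sets and functions -/

section Construction

variable (S : Set Thing.{u}) [Small.{u} S] (φ : Thing.{u} → Thing.{u})

/-- The set with the elements of `S`. -/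
noncomputable def mkSet : Thing.{u} :=
  ⟨ZFSet.pair ∅ (ZFSet.range fun s : S => s.1.1), .set fun _ hz => by
    obtain ⟨s, rfl⟩ := ZFSet.mem_range.1 hz
    exact s.1.2⟩

theorem isSet_mkSet : (mkSet S).IsSet := ⟨_, rfl⟩

@[simp] theorem elems_mkSet : (mkSet S).elems = S := by
  ext y
  constructor
  · rintro ⟨s, hs, hy⟩
    obtain rfl := (ZFSet.pair_inj.1 hs).2
    obtain ⟨a, ha⟩ := ZFSet.mem_range.1 hy
    obtain rfl : a.1 = y := Subtype.ext ha
    exact a.2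
  · exact fun hy => ⟨_, rfl, ZFSet.mem_range.2 ⟨⟨y, hy⟩, rfl⟩⟩

variable {S} in
theorem mem_elems_mkSet {a : Thing.{u}} : a ∈ (mkSet S).elems ↔ a ∈ S := by
  rw [elems_mkSet]

theorem isFunc_range_pair : ZFSet.IsFunc (ZFSet.range fun s : S => s.1.1)
    (ZFSet.range fun s : S => (φ s).1) (ZFSet.range fun s : S => ZFSet.pair s.1.1 (φ s).1) := by
  refine ⟨fun z hz => ?_, fun z hz => ?_⟩
  · obtain ⟨s, rfl⟩ := ZFSet.mem_range.1 hz
    exact ZFSet.pair_mem_prod.2 ⟨ZFSet.mem_range_self s, ZFSet.mem_range_self s⟩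
  · obtain ⟨s, rfl⟩ := ZFSet.mem_range.1 hz
    refine ⟨(φ s).1, ZFSet.mem_range_self s, fun w hw => ?_⟩
    obtain ⟨s', hs'⟩ := ZFSet.mem_range.1 hw
    obtain ⟨hss', rfl⟩ := ZFSet.pair_inj.1 hs'
    rw [Subtype.ext hss']

/-- The function on `S` that sends `a` to `φ a`. -/
noncomputable def mkFn : Thing.{u} :=
  ⟨ZFSet.pair {∅} (ZFSet.range fun s : S => ZFSet.pair s.1.1 (φ s).1),
    .fn (isFunc_range_pair S φ)
      (fun a ha => by
        obtain ⟨s, rfl⟩ := ZFSet.mem_range.1 ha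
        exact s.1.2)
      (fun b hb => by
        obtain ⟨s, rfl⟩ := ZFSet.mem_range.1 hb
        exact (φ s).2)⟩

variable {S φ}

theorem eq_mkSet_iff {x : Thing.{u}} : x = mkSet S ↔ x.IsSet ∧ x.elems = S := by
  constructor
  · rintro rfl
    exact ⟨isSet_mkSet S, elems_mkSet S⟩
  · rintro ⟨hx, h⟩
    exact hx.eq_of_elems_eq (isSet_mkSet S) (h.trans (elems_mkSet S).symm)

theorem mkSet_inj {S' : Set Thing.{u}} [Small.{u} S'] : mkSet S = mkSet S' ↔ S = S' := by
  rw [eq_mkSet_iff, elems_mkSet, and_iff_right (isSet_mkSet S)]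

theorem maps_mkFn {a b : Thing.{u}} : (mkFn S φ).Maps a b ↔ a ∈ S ∧ φ a = b := by
  constructor
  · rintro ⟨g, hg, hab⟩
    obtain rfl := (ZFSet.pair_inj.1 hg).2
    obtain ⟨s, hs⟩ := ZFSet.mem_range.1 hab
    obtain ⟨ha, hb⟩ := ZFSet.pair_inj.1 hs
    obtain rfl : s.1 = a := Subtype.ext ha
    exact ⟨s.2, Subtype.ext hb⟩
  · rintro ⟨ha, rfl⟩
    exact ⟨_, rfl, ZFSet.mem_range.2 ⟨⟨a, ha⟩, rfl⟩⟩

theorem isFunOn_mkFn : IsFunOn (mkSet S) (mkFn S φ) := by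
  refine ⟨⟨_, rfl⟩, isSet_mkSet S, ?_⟩
  ext a
  simp [dom, maps_mkFn]

theorem range_mkFn : (mkFn S φ).range = φ '' S := by
  ext b
  simp [range, maps_mkFn]

end Construction

theorem IsSet.mkSet_elems {x : Thing.{u}} (hx : x.IsSet) : mkSet x.elems = x :=
  (eq_mkSet_iff.2 ⟨hx, rfl⟩).symm

theorem IsSet.nonempty_elems {x : Thing.{u}} (hx : x.IsSet) (h : x ≠ mkSet ∅) :
    x.elems.Nonempty :=
  Set.nonempty_iff_ne_empty.2 fun he => h (eq_mkSet_iff.2 ⟨hx, he⟩)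

theorem IsSet.isFunOn_mkFn {x : Thing.{u}} (hx : x.IsSet) (φ : Thing.{u} → Thing.{u}) :
    IsFunOn x (mkFn x.elems φ) := by
  simpa only [hx.mkSet_elems] using Thing.isFunOn_mkFn (S := x.elems) (φ := φ)

instance : Nonempty Thing.{u} := ⟨mkSet ∅⟩

/-- `f : s ↠ t`. -/
def Surj (f s t : Thing.{u}) : Prop := IsFunOn s f ∧ t = mkSet f.range

/-- The value of `f` at `a`; it is arbitrary if `a` is not in the domain of `f`. -/
noncomputable def app (f a : Thing.{u}) : Thing.{u} := Classical.epsilon (f.Maps a)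

/-- The set `{a}`. -/
noncomputable def single (a : Thing.{u}) : Thing.{u} := mkSet {a}

/-- The set of all finite Zermelo ordinals `∅, {∅}, {{∅}}, …`. -/
noncomputable def zermelo : Thing.{u} := mkSet (Set.range fun n : ℕ => single^[n] (mkSet ∅))

/-- The two-tuple `(a, b) = {a, {a, b}}`. -/
noncomputable def tuple (a b : Thing.{u}) : Thing.{u} := mkSet {a, mkSet {a, b}}

theorem single_ne_empty (a : Thing.{u}) : single a ≠ mkSet ∅ := fun h =>
  Set.singleton_ne_empty a (mkSet_inj.1 h)

theorem mkSet_pair_right_inj {a b c : Thing.{u}} : mkSet {a, b} = mkSet {a, c} ↔ b = c := by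
  rw [mkSet_inj]
  grind [Set.pair_eq_pair_iff]

theorem tuple_injective2 : Function.Injective2 tuple.{u} := by
  intro a c b d h
  have rank_lt (a b : Thing) : a.rank < (mkSet {a, b}).rank :=
    rank_lt_of_mem_elems (by simp)
  have hac : a = c := by
    rcases Set.pair_eq_pair_iff.1 (mkSet_inj.1 h) with ⟨hac, -⟩ | ⟨ha, hc⟩
    · exact hac
    · have hlt := rank_lt a b
      rw [hc, ha] at hlt
      exact absurd (rank_lt c d) hlt.not_gt
  subst hac
  exact ⟨rfl, mkSet_pair_right_inj.1 (mkSet_pair_right_inj.1 h)⟩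

noncomputable instance instStructure : Structure Thing.{u} where
  IsSet := IsSet
  IsFunOn := IsFunOn
  elems := elems
  Surj := Surj
  Maps := Maps
  empty := mkSet ∅
  omega := zermelo
  inactive := mkFn ∅ id
  single := single
  app := app
  isSet_or_isFunOn x := x.isSet_or_isFn.imp_right fun hx =>
    ⟨mkSet x.dom, isSet_mkSet _, hx, isSet_mkSet _, (elems_mkSet _).symm⟩
  maps_app h := Classical.epsilon_spec h.exists

end Thing

/-! ### Validity of the postulates -/

open Formula Thing

theorem valid_extensionality : Valid Thing.{u} extensionality := by
  intro v F
  simp only [extensionality, Sat, sat_iff, Term.eval, push]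
  exact fun x hx y hy => ⟨fun h _ => h ▸ Iff.rfl, fun h => hx.eq_of_elems_eq hy (Set.ext h)⟩

theorem valid_functionsNotSets : Valid Thing.{u} functionsNotSets := by
  intro v F
  simp only [functionsNotSets, Sat, sat_neg, Term.eval, push]
  rintro x - f hf y hy rfl
  exact hf.1.not_isSet hy

theorem valid_setsInactive : Valid Thing.{u} setsInactive := by
  intro v F
  simp only [setsInactive, Sat, sat_and, sat_neg, Term.eval, push]
  exact fun x hx a b => ⟨fun h => h.1.1.not_isSet hx, fun h => (Maps.isFn h).not_isSet hx⟩

theorem valid_emptySet : Valid Thing.{u} emptySet := by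
  intro v F
  simp only [emptySet, Sat, sat_and, sat_neg, sat_exSet, Term.eval, push]
  exact ⟨_, isSet_mkSet ∅, rfl, fun _ => mem_elems_mkSet.not.2 (Set.notMem_empty _)⟩

theorem valid_pairing : Valid Thing.{u} pairing := by
  intro v F
  simp only [pairing, Sat, sat_iff, sat_or, sat_exSet, Term.eval, push]
  exact fun a b => ⟨_, isSet_mkSet {a, b}, fun _ => mem_elems_mkSet⟩

theorem valid_unionSet : Valid Thing.{u} unionSet := by
  intro v F
  simp only [unionSet, Sat, sat_and, sat_iff, sat_exSet, Term.eval, push]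
  refine fun x _ => ⟨_, isSet_mkSet (⋃ z : x.elems, z.1.elems), fun a => mem_elems_mkSet.trans ?_⟩
  simp only [Set.mem_iUnion, Subtype.exists, exists_prop]
  exact exists_congr fun z => ⟨fun h => ⟨isSet_of_mem_elems h.2, h⟩, fun h => h.2⟩

theorem valid_powerSet : Valid Thing.{u} powerSet := by
  intro v F
  simp only [powerSet, Sat, sat_and, sat_iff, sat_exSet, sat_allIn, Term.eval, push]
  refine fun x _ => ⟨_, isSet_mkSet {y | y.IsSet ∧ y.elems ⊆ x.elems}, fun y => ?_⟩
  exact mem_elems_mkSet.trans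
    ⟨fun h => ⟨y, h.1, h.2, rfl⟩, fun ⟨z, hz, h, hyz⟩ => hyz ▸ ⟨hz, h⟩⟩

theorem valid_regularity : Valid Thing.{u} regularity := by
  intro v F
  simp only [regularity, Sat, sat_and, sat_neg, sat_ex, Term.eval, push]
  exact fun _ hx h => exists_minimal_mem (hx.nonempty_elems h)

theorem mem_elems_zermelo {a : Thing.{u}} :
    a ∈ zermelo.elems ↔ ∃ n : ℕ, single^[n] (mkSet ∅) = a := by
  rw [zermelo, elems_mkSet, Set.mem_range]

theorem valid_infiniteSet : Valid Thing.{u} infiniteSet := by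
  intro v F
  simp only [infiniteSet, Sat, sat_and, sat_neg, sat_iff, sat_exSet, sat_allIn, sat_exIn,
    Term.eval, push]
  refine ⟨_, isSet_mkSet _, rfl, mem_elems_zermelo.2 ⟨0, rfl⟩, fun a ha => ?_, fun a ha => ?_⟩ <;>
    obtain ⟨n, rfl⟩ := mem_elems_zermelo.1 ha
  · exact mem_elems_zermelo.2 ⟨n + 1, Function.iterate_succ_apply' ..⟩
  · refine ⟨fun h => ?_, fun h ⟨b, _, hb⟩ => single_ne_empty b (hb.symm.trans h)⟩
    cases n with
    | zero => rfl
    | succ n =>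
      exact absurd ⟨_, mem_elems_zermelo.2 ⟨n, rfl⟩, Function.iterate_succ_apply' ..⟩ h

theorem valid_successor : Valid Thing.{u} successor := by
  intro v F
  simp only [successor, Sat, sat_and, sat_iff, sat_exSet, Term.eval, push]
  refine fun a b => eq_mkSet_iff.trans ⟨fun ⟨hb, h⟩ => ⟨b, hb, rfl, Set.ext_iff.1 h⟩, ?_⟩
  rintro ⟨_, hb, rfl, h⟩
  exact ⟨hb, Set.ext h⟩

theorem valid_functionsNoElements : Valid Thing.{u} functionsNoElements := by
  intro v F
  simp only [functionsNoElements, Sat, sat_neg, Term.eval, push]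
  exact fun x _ f hf a ha => hf.1.not_isSet (isSet_of_mem_elems ha)

theorem valid_functionsAct : Valid Thing.{u} functionsAct := by
  intro v F
  simp only [functionsAct, Sat, sat_neg, sat_and, sat_exSet, sat_allIn, sat_exUnique, Term.eval,
    push]
  refine fun x hx f hf _ => ⟨x, hx, _, isSet_mkSet _, ⟨hf, rfl⟩, fun a ha => ?_⟩
  obtain ⟨b, hb⟩ : a ∈ f.dom := hf.2.2.superset ha
  exact ⟨b, hb, fun c hc => Maps.unique hc hb⟩

theorem valid_uniqueDomain : Valid Thing.{u} uniqueDomain := by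
  intro v F
  simp only [uniqueDomain, Sat, sat_neg, Term.eval, push]
  exact fun x hx f hf a ha b h => ha (h.1.2.1.eq_of_elems_eq hx (h.1.2.2.symm.trans hf.2.2))

theorem valid_noActionOutside : Valid Thing.{u} noActionOutside := by
  intro v F
  simp only [noActionOutside, Sat, sat_neg, Term.eval, push]
  exact fun _ _ f hf a ha b h => ha (hf.2.2.subset ⟨b, h⟩)

theorem valid_imageSet : Valid Thing.{u} imageSet := by
  intro v F
  simp only [imageSet, Sat, sat_neg, sat_and, sat_iff, sat_exSet, sat_exIn, Term.eval, push]
  rintro x - f hf - _ ⟨-, rfl⟩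
  refine ⟨_, isSet_mkSet _, rfl, fun b => ?_⟩
  have mem_of_maps {a : Thing} (h : f.Maps a b) : a ∈ x.elems := hf.2.2.subset ⟨b, h⟩
  exact mem_elems_mkSet.trans ⟨fun ⟨a, h⟩ => ⟨a, mem_of_maps h, h⟩, fun ⟨a, _, h⟩ => ⟨a, h⟩⟩

theorem valid_inverseImageSet : Valid Thing.{u} inverseImageSet := by
  intro v F
  simp only [inverseImageSet, Sat, sat_neg, sat_and, sat_iff, sat_exSet, Term.eval, push]
  exact fun x _ _ f _ _ _ _ b =>
    ⟨_, isSet_mkSet {a | a ∈ x.elems ∧ f.Maps a b}, fun _ => mem_elems_mkSet⟩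

theorem valid_inactiveFunction : Valid Thing.{u} inactiveFunction := by
  intro v F
  simp only [inactiveFunction, Sat, sat_neg, sat_and, sat_exFun, Term.eval, push]
  refine ⟨_, isFunOn_mkFn, rfl, ⟨isFunOn_mkFn, ?_⟩, fun a b h => (maps_mkFn.1 h).1⟩
  exact mkSet_inj.2 (by rw [range_mkFn, Set.image_empty])

theorem valid_urFunction : Valid Thing.{u} urFunction := by
  intro v F
  simp only [urFunction, Sat, sat_and, sat_exFun, Term.eval, push]
  refine fun a b => ⟨mkFn {a} fun _ => b, isFunOn_mkFn, ⟨isFunOn_mkFn, ?_⟩, maps_mkFn.2 ⟨rfl, rfl⟩⟩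
  exact mkSet_inj.2 (by rw [range_mkFn, Set.image_singleton])

theorem valid_functionRegularity : Valid Thing.{u} functionRegularity := by
  intro v F
  simp only [functionRegularity, Sat, sat_neg, sat_and, Term.eval, push]
  exact fun _ _ f _ _ _ _ a =>
    ⟨fun h => (Maps.rank_left_lt h).false, fun h => (Maps.rank_right_lt h).false⟩

theorem valid_separation (φ : Formula) : Valid Thing.{u} (separation φ) := by
  intro v F
  simp only [separation, Sat, sat_and, sat_iff, sat_exSet, Term.eval, push, sat_subst, eval_scons]
  exact fun x _ =>
    ⟨_, isSet_mkSet {a | a ∈ x.elems ∧ φ.Sat (push a (push x v)) F}, fun _ => mem_elems_mkSet⟩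

theorem valid_replacement (ψ : Formula) : Valid Thing.{u} (replacement ψ) := by
  intro v F
  simp only [replacement, Sat, sat_iff, sat_exSet, sat_allIn, sat_exIn, sat_exUnique,
    Term.eval, push, sat_subst, eval_scons]
  intro x _ h
  choose! φ hφ hφ' using h
  refine ⟨_, isSet_mkSet (φ '' x.elems), fun b => mem_elems_mkSet.trans ?_⟩
  refine exists_congr fun a => and_congr_right fun ha => ?_
  exact ⟨fun hab => hab ▸ hφ a ha, fun hab => (hφ' a ha b hab).symm⟩

section Tuples

variable (v : ℕ → Thing.{u}) (F : ℕ → Thing.{u} → Thing.{u}) (a b t : Term)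

theorem sat_isPairSet :
    (isPairSet t a b).Sat v F ↔
      (t.eval v F).IsSet ∧ (t.eval v F).elems = {a.eval v F, b.eval v F} := by
  simp only [isPairSet, Sat, sat_and, sat_iff, sat_or, sat_isSet, Term.eval_shift, Term.eval, push]
  rw [Set.ext_iff]
  rfl

theorem sat_isTuple :
    (isTuple t a b).Sat v F ↔ t.eval v F = tuple (a.eval v F) (b.eval v F) := by
  simp only [isTuple, sat_ex, sat_and, sat_isPairSet, Term.eval_shift, Term.eval, push,
    ← eq_mkSet_iff, exists_eq_left, tuple]

theorem sat_tupleMem :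
    (tupleMem a b t).Sat v F ↔ tuple (a.eval v F) (b.eval v F) ∈ (t.eval v F).elems := by
  simp only [tupleMem, sat_exIn, sat_isTuple, Term.eval_shift, Term.eval, push,
    exists_eq_right]
  rfl

end Tuples

theorem valid_reverseGraph : Valid Thing.{u} reverseGraph := by
  intro v F
  simp only [reverseGraph, isGraph, Sat, sat_and, sat_iff, sat_isSet, sat_exFun, sat_allIn,
    sat_exIn, sat_exUnique, sat_isTuple, sat_tupleMem, Term.eval_shift, Term.eval, push]
  rintro g - x hx y - ⟨-, hg, hfun⟩
  choose! φ hφ hφ' using hfun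
  refine ⟨_, hx.isFunOn_mkFn φ, fun a b => maps_mkFn.trans ⟨?_, fun hab => ?_⟩⟩
  · rintro ⟨ha, rfl⟩
    exact hφ a ha
  · obtain ⟨c, hc, d, -, hcd⟩ := hg _ hab
    obtain ⟨rfl, rfl⟩ := tuple_injective2 hcd
    exact ⟨hc, (hφ' a hc b hab).symm⟩

theorem valid_sumF : Valid Thing.{u} sumF := by
  intro v F
  simp only [sumF, Sat, sat_and, sat_exFun, sat_exSet, Term.eval, push]
  intro x hx G _
  have hf : IsFunOn x (mkFn x.elems fun ξ => (G ξ).app ξ) := hx.isFunOn_mkFn _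
  exact ⟨_, hf, _, isSet_mkSet _, ⟨hf, rfl⟩, fun ξ hξ => maps_mkFn.2 ⟨hξ, rfl⟩⟩

theorem valid_of_mem_basicPostulates {φ : Formula} (h : φ ∈ basicPostulates) :
    Valid Thing.{u} φ := by
  rcases h with rfl | rfl | rfl | rfl | rfl | rfl | rfl | rfl | rfl | rfl | rfl | rfl | rfl | rfl |
    rfl | rfl | rfl | rfl | rfl
  exacts [valid_extensionality, valid_functionsNotSets, valid_setsInactive, valid_emptySet,
    valid_pairing, valid_unionSet, valid_powerSet, valid_regularity, valid_infiniteSet,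
    valid_successor, valid_functionsNoElements, valid_functionsAct, valid_uniqueDomain,
    valid_noActionOutside, valid_imageSet, valid_inverseImageSet, valid_inactiveFunction,
    valid_urFunction, valid_functionRegularity]

/-- The postulates of `theoryT0` and of `theoryT` taken together, with separation and replacement
for all formulas, including those with multiple quantifiers and conjunctive operators. -/
def fullTheory : Set Formula :=
  basicPostulates ∪ Set.range separation ∪ Set.range replacement ∪ {reverseGraph, sumF}

theorem valid_of_mem_fullTheory {φ : Formula} (h : φ ∈ fullTheory) : Valid Thing.{u} φ := by
  rcases h with ((h | ⟨φ, rfl⟩) | ⟨ψ, rfl⟩) | rfl | rfl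
  exacts [valid_of_mem_basicPostulates h, valid_separation φ, valid_replacement ψ,
    valid_reverseGraph, valid_sumF]

theorem theoryT0_union_sumF_subset_fullTheory : theoryT0 ∪ {sumF} ⊆ fullTheory := by
  rintro _ ((((h | ⟨φ, -, rfl⟩) | ⟨ψ, -, rfl⟩) | rfl) | rfl)
  exacts [.inl (.inl (.inl h)), .inl (.inl (.inr ⟨φ, rfl⟩)), .inl (.inr ⟨ψ, rfl⟩),
    .inr (.inl rfl), .inr (.inr rfl)]

theorem theoryT_subset_fullTheory : theoryT ⊆ fullTheory := by
  rintro _ (h | rfl)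
  exacts [.inl (.inl (.inl h)), .inr (.inr rfl)]

end FunSet

theorem mainTheorem4_general : FunSet.Consistent FunSet.fullTheory :=
  FunSet.consistent_of_valid FunSet.Thing.{0} fun _ => FunSet.valid_of_mem_fullTheory

theorem mainTheorem4 :
    ¬ FunSet.Entails FunSet.theoryT0 FunSet.sumF.neg ∧
    (FunSet.Consistent FunSet.theoryT0 →
      FunSet.Consistent (FunSet.theoryT0 ∪ {FunSet.sumF}) ∧
      FunSet.Consistent FunSet.theoryT) :=
  have hsum := mainTheorem4_general.mono FunSet.theoryT0_union_sumF_subset_fullTheory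
  ⟨hsum.not_entails_neg, fun _ =>
    ⟨hsum, mainTheorem4_general.mono FunSet.theoryT_subset_fullTheory⟩⟩
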